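/- A grid-labelled graph of type $(3,3)$ is a simple graph $G$ together with a bijective labelling of its vertices by the points $(i,j)$, $i,j\in\{1,2,3\}$ ($i$ is the row, $j$ the column), of the $3\times 3$ grid; its edges are written $\{(i,j),(k,l)\}$ by means of the labels. An edge $\{(i,j),(k,l)\}$ is diagonal if $i\ne k$ and $j\ne l$. The partial transpose $\Gamma(G)$ of $G$ is obtained by replacing every edge $\{(i,j),(k,l)\}$ by $\{(k,j),(i,l)\}$, and $G$ satisfies the degree criterion if every grid point has the same degree in $G$ and in $\Gamma(G)$. Two grid-labelled graphs of type $(3,3)$ are locally isomorphic if one is obtained from the other by permuting the rows and permuting the columns of the grid. A rotation of a grid-labelled graph of type $(3,3)$ is its image under a rotation of the grid by a multiple of $90^\circ$ (the trivial rotation included). The building blocks are the four grid-labelled graphs of type $(3,3)$ with the following edges: - criss-cross $B_2$: $\{(1,1),(2,2)\}$, $\{(1,2),(2,1)\}$; - tally $B_3$: $\{(1,1),(2,2)\}$, $\{(1,2),(2,3)\}$, $\{(2,1),(1,3)\}$; - cross-hatch $B_4$: $\{(1,1),(2,3)\}$, $\{(2,1),(3,3)\}$, $\{(1,2),(3,1)\}$,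 $\{(1,3),(3,2)\}$; - skew-mesh $B_5$: $\{(1,1),(3,3)\}$, $\{(1,2),(2,1)\}$, $\{(1,3),(2,2)\}$, $\{(2,2),(3,1)\}$, $\{(2,3),(3,2)\}$. **Proposition.** Let $G$ be a grid-labelled graph of type $(3,3)$ all of whose edges are diagonal. Then $G$ satisfies the degree criterion if and only if there are $n\ge 0$ and pairwise edge-disjoint subgraphs $X_1,\dots,X_n$ of $G$ (with the same vertices and labels) whose union is $G$, such that each $X_i$ is locally isomorphic to a rotation of a building block. -/

import Mathlib

/-- A grid-labelled graph of type `(a, b)`: a simple graph together with a bijective labelling of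
its vertices by the points of the `a × b` grid. The point in row `i` and column `j` is written
`(i, j)`; rows and columns are numbered from `0`, as usual for `Fin`. -/
structure GridLabelledGraph (V : Type*) (a b : ℕ) where
  /-- the underlying simple graph -/
  graph : SimpleGraph V
  /-- the bijective labelling -/
  label : V ≃ Fin a × Fin b

namespace GridLabelledGraph

/-- The graph drawn on the grid: two grid points are adjacent when the vertices carrying these
labels are adjacent. Its edge set is the set of edges `{(i, j), (k, l)}` of the grid-labelled
graph. -/
def onGrid {V : Type*} {a b : ℕ} (G : GridLabelledGraph V a b) :
    SimpleGraph (Fin a × Fin b) :=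
  G.graph.comap G.label.symm

/-- All edges `{(i, j), (k, l)}` are diagonal, that is, `i ≠ k` and `j ≠ l`: there are no horizontal
and no vertical edges. -/
def OnlyDiagonalEdges {V : Type*} {a b : ℕ} (G : GridLabelledGraph V a b) : Prop :=
  ∀ (i k : Fin a) (j l : Fin b), s((i, j), (k, l)) ∈ G.onGrid.edgeSet → i ≠ k ∧ j ≠ l

/-- The partial transpose: every edge `{(i, j), (k, l)}` is replaced by `{(k, j), (i, l)}`. -/
def partialTranspose {V : Type*} {a b : ℕ} (G : GridLabelledGraph V a b) :
    GridLabelledGraph V a b where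
  graph :=
    { Adj := fun u v =>
        G.onGrid.Adj ((G.label v).1, (G.label u).2) ((G.label u).1, (G.label v).2)
      symm := ⟨fun _ _ h => h.symm⟩
      loopless := ⟨fun _ h => G.onGrid.irrefl h⟩ }
  label := G.label

open Classical in
/-- The degree matrix, indexed by the points of the grid. -/
noncomputable def degreeMatrix {V : Type*} {a b : ℕ} (G : GridLabelledGraph V a b) :
    Matrix (Fin a × Fin b) (Fin a × Fin b) ℤ :=
  G.onGrid.degMatrix ℤ

/-- The degree criterion: the degree matrix is unchanged by the partial transpose. -/
def DegreeCriterion {V : Type*} {a b : ℕ} (G : GridLabelledGraph V a b) : Prop :=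
  G.degreeMatrix = G.partialTranspose.degreeMatrix

/-- `H` is a subgraph of `G`: same labelling, and every edge of `H` is an edge of `G`. -/
def IsSubgraph {V : Type*} {a b : ℕ} (H G : GridLabelledGraph V a b) : Prop :=
  H.label = G.label ∧ H.graph.edgeSet ⊆ G.graph.edgeSet

/-- `X 0, …, X (n - 1)` is a decomposition of `G`: pairwise edge-disjoint subgraphs of `G` whose
union is `G`. -/
def IsDecomposition {V : Type*} {a b n : ℕ} (G : GridLabelledGraph V a b)
    (X : Fin n → GridLabelledGraph V a b) : Prop :=
  (∀ i, (X i).IsSubgraph G) ∧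
  (∀ i j, i ≠ j → Disjoint (X i).graph.edgeSet (X j).graph.edgeSet) ∧
  (⋃ i, (X i).graph.edgeSet) = G.graph.edgeSet

/-- Local isomorphism: a permutation `π` of the rows and a permutation `σ` of the columns carry one
adjacency matrix to the other. -/
def LocallyIsomorphic {V W : Type*} {a b : ℕ} (G : GridLabelledGraph V a b)
    (H : GridLabelledGraph W a b) : Prop :=
  ∃ (π : Equiv.Perm (Fin a)) (σ : Equiv.Perm (Fin b)), ∀ (i k : Fin a) (j l : Fin b),
    G.onGrid.Adj (i, j) (k, l) ↔ H.onGrid.Adj (π i, σ j) (π k, σ l)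

/-- The clockwise quarter turn of the `n × n` grid: row `i` becomes column `n - 1 - i`, and column
`j` becomes row `j`. -/
def quarterTurn (n : ℕ) : Fin n × Fin n ≃ Fin n × Fin n where
  toFun p := (p.2, p.1.rev)
  invFun p := (p.2.rev, p.1)
  left_inv p := by simp
  right_inv p := by simp

/-- The graph turned by 90 degrees on a square grid. -/
def rotate {V : Type*} {n : ℕ} (G : GridLabelledGraph V n n) : GridLabelledGraph V n n where
  graph := G.graph
  label := G.label.trans (quarterTurn n)

/-- `H` is a rotation of `G`, by some multiple of 90 degrees (the multiple `0` is allowed). -/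
def IsRotationOf {V : Type*} {n : ℕ} (H G : GridLabelledGraph V n n) : Prop :=
  ∃ r : ℕ, H = rotate^[r] G

/-- The grid-labelled graph of type `(a, b)` with a given set of edges, whose vertices are the grid
points themselves. -/
def ofEdges {a b : ℕ} (E : Set (Sym2 (Fin a × Fin b))) :
    GridLabelledGraph (Fin a × Fin b) a b where
  graph := SimpleGraph.fromEdgeSet E
  label := Equiv.refl _

/-- The criss-cross. -/
def crissCross : GridLabelledGraph (Fin 3 × Fin 3) 3 3 :=
  ofEdges {s((0, 0), (1, 1)), s((0, 1), (1, 0))}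

/-- The tally. -/
def tally : GridLabelledGraph (Fin 3 × Fin 3) 3 3 :=
  ofEdges {s((0, 0), (1, 1)), s((0, 1), (1, 2)), s((1, 0), (0, 2))}

/-- The cross-hatch. -/
def crossHatch : GridLabelledGraph (Fin 3 × Fin 3) 3 3 :=
  ofEdges {s((0, 0), (1, 2)), s((1, 0), (2, 2)), s((0, 1), (2, 0)), s((0, 2), (2, 1))}

/-- The skew-mesh. -/
def skewMesh : GridLabelledGraph (Fin 3 × Fin 3) 3 3 :=
  ofEdges {s((0, 0), (2, 2)), s((0, 1), (1, 0)), s((0, 2), (1, 1)), s((1, 1), (2, 0)),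
    s((1, 2), (2, 1))}

/-- The four building blocks. -/
def IsBuildingBlock (B : GridLabelledGraph (Fin 3 × Fin 3) 3 3) : Prop :=
  B = crissCross ∨ B = tally ∨ B = crossHatch ∨ B = skewMesh

end GridLabelledGraph

/-! The excess of a grid point (degree in the graph minus degree in the partial transpose) is
additive over edge-disjoint unions, invariant up to relabelling under row and column permutations
and rotations, and zero on the blocks. So a union of block copies satisfies the criterion.

Conversely, by induction on the number of edges it suffices to remove one block copy from a nonempty
diagonal graph of zero excess (`exists_isBlockCopy_le`). If some rectangle has both diagonals as
edges, it is a criss-cross. Otherwise the graph is encoded by the nine signs of its rectangles, a 3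
× 3 matrix with entries in {-1, 0, 1}. Zero excess makes this matrix a sum of a row function and a
column function, hence determined by its first row and column. A check of these at most 3^5 matrices
finds a block copy in every nonzero case (`exists_place_forcesEdge`). -/

namespace GridLabelledGraph

/-- A permutation of `Fin 3`, as an affine map. -/
def affinePerm (c : Fin 3) (s : Bool) : Equiv.Perm (Fin 3) where
  toFun i := bif s then c - i else c + i
  invFun i := bif s then c - i else i - c
  left_inv := by revert c s; decide
  right_inv := by revert c s; decide

/-- The edges of the building blocks, as lists. -/
def blockEdges : Fin 4 → List ((Fin 3 × Fin 3) × (Fin 3 × Fin 3))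
  | 0 => [((0, 0), (1, 1)), ((0, 1), (1, 0))]
  | 1 => [((0, 0), (1, 1)), ((0, 1), (1, 2)), ((1, 0), (0, 2))]
  | 2 => [((0, 0), (1, 2)), ((1, 0), (2, 2)), ((0, 1), (2, 0)), ((0, 2), (2, 1))]
  | 3 => [((0, 0), (2, 2)), ((0, 1), (1, 0)), ((0, 2), (1, 1)), ((1, 1), (2, 0)), ((1, 2), (2, 1))]

/-- The building blocks, numbered. -/
def block (m : Fin 4) : GridLabelledGraph (Fin 3 × Fin 3) 3 3 :=
  ofEdges {e | ∃ x ∈ blockEdges m, e = s(x.1, x.2)}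

theorem isBuildingBlock_iff (B : GridLabelledGraph (Fin 3 × Fin 3) 3 3) :
    B.IsBuildingBlock ↔ ∃ m, B = block m := by
  have h0 : block 0 = crissCross := by
    unfold block crissCross; congr 1; ext e; simp [blockEdges]
  have h1 : block 1 = tally := by
    unfold block tally; congr 1; ext e; simp [blockEdges]
  have h2 : block 2 = crossHatch := by
    unfold block crossHatch; congr 1; ext e; simp [blockEdges]
  have h3 : block 3 = skewMesh := by
    unfold block skewMesh; congr 1; ext e; simp [blockEdges]
  constructor
  · rintro (rfl | rfl | rfl | rfl)
    exacts [⟨0, h0.symm⟩, ⟨1, h1.symm⟩, ⟨2, h2.symm⟩, ⟨3, h3.symm⟩]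
  · rintro ⟨m, rfl⟩
    fin_cases m
    exacts [Or.inl h0, Or.inr (Or.inl h1), Or.inr (Or.inr (Or.inl h2)),
      Or.inr (Or.inr (Or.inr h3))]

theorem block_adj_iff (m : Fin 4) (p q : Fin 3 × Fin 3) :
    (block m).onGrid.Adj p q ↔ (p, q) ∈ blockEdges m ∨ (q, p) ∈ blockEdges m := by
  have hne : ∀ m : Fin 4, ∀ x ∈ blockEdges m, x.1 ≠ x.2 := by decide
  simp only [block, onGrid, ofEdges, SimpleGraph.comap_adj, Equiv.refl_symm, Equiv.coe_refl,
    id, SimpleGraph.fromEdgeSet_adj, Set.mem_ofPred_eq, Sym2.eq_iff]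
  constructor
  · rintro ⟨⟨x, hx, ⟨rfl, rfl⟩ | ⟨rfl, rfl⟩⟩, -⟩
    exacts [Or.inl hx, Or.inr hx]
  · rintro (h | h)
    exacts [⟨⟨_, h, Or.inl ⟨rfl, rfl⟩⟩, hne m _ h⟩, ⟨⟨_, h, Or.inr ⟨rfl, rfl⟩⟩, (hne m _ h).symm⟩]

/-! ### Degree excess and its symmetries -/

open Classical in
/-- The degree of `p` minus its degree in the partial transpose. -/
noncomputable def excess (H : SimpleGraph (Fin 3 × Fin 3)) (p : Fin 3 × Fin 3) : ℤ :=
  ∑ k, ∑ l, ((if H.Adj p (k, l) then 1 else 0) - (if H.Adj (k, p.2) (p.1, l) then 1 else 0))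

theorem degreeCriterion_iff {V : Type*} (G : GridLabelledGraph V 3 3) :
    G.DegreeCriterion ↔ ∀ p, excess G.onGrid p = 0 := by
  classical
  have key : ∀ p, excess G.onGrid p
      = (G.onGrid.degree p : ℤ) - (G.partialTranspose.onGrid.degree p : ℤ) := by
    intro p
    have hd : ∀ (H : SimpleGraph (Fin 3 × Fin 3)),
        (H.degree p : ℤ) = ∑ k, ∑ l, if H.Adj p (k, l) then 1 else 0 := by
      intro H
      rw [← SimpleGraph.card_neighborFinset_eq_degree, SimpleGraph.neighborFinset_eq_filter,
        Finset.card_filter, Fintype.sum_prod_type]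
      push_cast
      rfl
    rw [hd, hd]
    simp only [excess, Finset.sum_sub_distrib]
    congr 1
    simp [onGrid, partialTranspose]
  unfold DegreeCriterion degreeMatrix SimpleGraph.degMatrix
  rw [Matrix.diagonal_eq_diagonal_iff]
  refine forall_congr' fun p => ?_
  rw [key, sub_eq_zero]

theorem excess_comap_prodMap (H : SimpleGraph (Fin 3 × Fin 3)) (π σ : Equiv.Perm (Fin 3))
    (i j : Fin 3) :
    excess (H.comap (Prod.map π σ)) (i, j) = excess H (π i, σ j) := by
  classical
  simp only [excess, SimpleGraph.comap_adj, Prod.map_apply]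
  rw [← Equiv.sum_comp π (fun k => ∑ l, ((if H.Adj (π i, σ j) (k, l) then (1 : ℤ) else 0) -
    (if H.Adj (k, σ j) (π i, l) then 1 else 0)))]
  exact Finset.sum_congr rfl fun k _ => Equiv.sum_comp σ (fun l =>
    (if H.Adj (π i, σ j) (π k, l) then (1 : ℤ) else 0) -
      (if H.Adj (π k, σ j) (π i, l) then 1 else 0)) |>.symm ▸ rfl

theorem excess_rotate {V : Type*} (G : GridLabelledGraph V 3 3) (i j : Fin 3) :
    excess (rotate G).onGrid (i, j) = excess G.onGrid (j.rev, i) := by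
  classical
  have h : ∀ p q, (rotate G).onGrid.Adj p q ↔ G.onGrid.Adj (p.2.rev, p.1) (q.2.rev, q.1) :=
    fun p q => Iff.rfl
  simp only [excess, h]
  rw [Finset.sum_comm, ← Equiv.sum_comp Fin.revPerm]
  refine Finset.sum_congr rfl fun k _ => Finset.sum_congr rfl fun l _ => ?_
  simp only [Fin.revPerm_apply, Fin.rev_rev]
  -- The turn interchanges the roles of rows and columns, but transposing either coordinate yields
  -- the same unordered edge.
  rw [G.onGrid.adj_comm (j.rev, l)]

theorem excess_block (m : Fin 4) (p : Fin 3 × Fin 3) : excess (block m).onGrid p = 0 := by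
  have h : ∀ (m : Fin 4) (p : Fin 3 × Fin 3), ∑ k, ∑ l,
      ((if (p, (k, l)) ∈ blockEdges m ∨ ((k, l), p) ∈ blockEdges m then (1 : ℤ) else 0) -
        (if ((k, p.2), (p.1, l)) ∈ blockEdges m ∨ ((p.1, l), (k, p.2)) ∈ blockEdges m
          then 1 else 0)) = 0 := by
    decide +kernel
  rw [← h m p]
  unfold excess
  refine Finset.sum_congr rfl fun k _ => Finset.sum_congr rfl fun l _ => ?_
  simp only [block_adj_iff]

/-! ### Copies of building blocks -/

/-- A graph on the grid which is locally isomorphic to a rotation of a building block. -/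
def IsBlockCopy (H : SimpleGraph (Fin 3 × Fin 3)) : Prop :=
  ∃ B R : GridLabelledGraph (Fin 3 × Fin 3) 3 3, B.IsBuildingBlock ∧ R.IsRotationOf B ∧
    ∃ π σ : Equiv.Perm (Fin 3), ∀ i k j l,
      H.Adj (i, j) (k, l) ↔ R.onGrid.Adj (π i, σ j) (π k, σ l)

theorem IsBlockCopy.excess_eq_zero {H : SimpleGraph (Fin 3 × Fin 3)} (hH : IsBlockCopy H)
    (p : Fin 3 × Fin 3) : excess H p = 0 := by
  obtain ⟨B, R, hB, ⟨r, rfl⟩, π, σ, h⟩ := hH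
  obtain ⟨m, rfl⟩ := (isBuildingBlock_iff B).1 hB
  have hH : H = (rotate^[r] (block m)).onGrid.comap (Prod.map π σ) := by
    ext ⟨i, j⟩ ⟨k, l⟩
    exact h i k j l
  have hr : ∀ p, excess (rotate^[r] (block m)).onGrid p = 0 := by
    clear h hH
    induction r with
    | zero => exact excess_block m
    | succ r ih =>
      rintro ⟨i, j⟩
      rw [Function.iterate_succ_apply', excess_rotate]
      exact ih _
  rw [hH, excess_comap_prodMap]
  exact hr _

/-- The position of a grid point after an optional quarter turn and an affine permutation of the
rows and of the columns. -/
def place (t : Bool) (c : Fin 3) (s : Bool) (c' : Fin 3) (s' : Bool) (p : Fin 3 × Fin 3) :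
    Fin 3 × Fin 3 :=
  bif t then (affinePerm c s p.2, affinePerm c' s' p.1.rev)
  else (affinePerm c s p.1, affinePerm c' s' p.2)

/-- A half turn only reverses rows and columns, so one optional quarter turn suffices. The six
affine maps are all the permutations of `Fin 3`. Hence copies are enumerated by finite, decidable
data. -/
theorem exists_isBlockCopy_le_of_place {A : SimpleGraph (Fin 3 × Fin 3)} (m : Fin 4) (t : Bool)
    (c : Fin 3) (s : Bool) (c' : Fin 3) (s' : Bool)
    (h : ∀ x ∈ blockEdges m, A.Adj (place t c s c' s' x.1) (place t c s c' s' x.2)) :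
    ∃ H ≤ A, IsBlockCopy H ∧ H ≠ ⊥ := by
  have h2 : ∀ p q, (block m).onGrid.Adj p q →
      A.Adj (place t c s c' s' p) (place t c s c' s' q) := by
    intro p q hpq
    rcases (block_adj_iff m p q).1 hpq with hx | hx
    exacts [h _ hx, (h _ hx).symm]
  have hadj : ∃ p q, (block m).onGrid.Adj p q := by
    have : ∀ m, ∃ p q, (p, q) ∈ blockEdges m := by decide
    obtain ⟨p, q, hpq⟩ := this m
    exact ⟨p, q, (block_adj_iff m p q).2 (Or.inl hpq)⟩
  obtain ⟨p₀, q₀, h₀⟩ := hadj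
  let R := rotate^[t.toNat] (block m)
  let e : Equiv.Perm (Fin 3 × Fin 3) :=
    Equiv.prodCongr (affinePerm c s).symm (affinePerm c' s').symm
  have hR : ∀ p q, R.onGrid.Adj (e (place t c s c' s' p)) (e (place t c s c' s' q)) ↔
      (block m).onGrid.Adj p q := by
    intro p q
    cases t
    · simp [R, e, place]
    · have hrot : ∀ p q, (rotate (block m)).onGrid.Adj p q ↔
          (block m).onGrid.Adj (p.2.rev, p.1) (q.2.rev, q.1) := fun p q => Iff.rfl
      simp [R, e, place, hrot]
  have hsurj : Function.Surjective (place t c s c' s') := by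
    rintro ⟨i, j⟩
    cases t
    · exact ⟨((affinePerm c s).symm i, (affinePerm c' s').symm j), by simp [place]⟩
    · exact ⟨(((affinePerm c' s').symm j).rev, (affinePerm c s).symm i), by simp [place]⟩
  refine ⟨R.onGrid.comap e, ?_, ⟨block m, R, (isBuildingBlock_iff _).2 ⟨m, rfl⟩, ⟨_, rfl⟩,
    (affinePerm c s).symm, (affinePerm c' s').symm, fun _ _ _ _ => Iff.rfl⟩, ?_⟩
  · intro x y hxy
    obtain ⟨p, rfl⟩ := hsurj x
    obtain ⟨q, rfl⟩ := hsurj y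
    exact h2 _ _ ((hR p q).1 hxy)
  · intro hbot
    have h1 : (R.onGrid.comap e).Adj (place t c s c' s' p₀) (place t c s c' s' q₀) :=
      (hR _ _).2 h₀
    rw [hbot] at h1
    exact h1

/-! ### Finite check on sign matrices -/

/-- Whether the matrix `y` forces the edge `{p, q}`: its entry at `(a, b)` is the difference of the
numbers of edges `{(a + 1, b + 1), (a + 2, b + 2)}` and `{(a + 2, b + 1), (a + 1, b + 2)}`. -/
def forcesEdge (y : Fin 3 → Fin 3 → ℤ) (p q : Fin 3 × Fin 3) : Bool :=
  bif q.1 == p.1 + 1 then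
    (bif q.2 == p.2 + 1 then y (p.1 + 2) (p.2 + 2) == 1
      else bif q.2 == p.2 + 2 then y (p.1 + 2) (p.2 + 1) == -1 else false)
  else bif q.1 == p.1 + 2 then
    (bif q.2 == p.2 + 2 then y (p.1 + 1) (p.2 + 1) == 1
      else bif q.2 == p.2 + 1 then y (p.1 + 1) (p.2 + 2) == -1 else false)
  else false

/-- The matrix whose differences of rows are constant, given by its first column and first row. -/
def additiveMatrix (x₀ x₁ x₂ x₃ x₄ : ℤ) : Fin 3 → Fin 3 → ℤ
  | 0, 0 => x₀
  | 0, 1 => x₁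
  | 0, 2 => x₂
  | 1, 0 => x₃
  | 2, 0 => x₄
  | 1, 1 => x₃ + x₁ - x₀
  | 1, 2 => x₃ + x₂ - x₀
  | 2, 1 => x₄ + x₁ - x₀
  | 2, 2 => x₄ + x₂ - x₀

/-- Five entries fix the matrix, so the kernel can run through all cases. Only edges forced by a
nonzero sign are used, so the copy found lies in every graph with this matrix. -/
theorem exists_place_forcesEdge : ∀ x₀ ∈ [(-1 : ℤ), 0, 1], ∀ x₁ ∈ [(-1 : ℤ), 0, 1],
    ∀ x₂ ∈ [(-1 : ℤ), 0, 1], ∀ x₃ ∈ [(-1 : ℤ), 0, 1], ∀ x₄ ∈ [(-1 : ℤ), 0, 1],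
    (∀ a b, additiveMatrix x₀ x₁ x₂ x₃ x₄ a b ∈ [(-1 : ℤ), 0, 1]) →
    (∀ a b, additiveMatrix x₀ x₁ x₂ x₃ x₄ a b = 0) ∨
    ∃ m t c s c' s', ∀ x ∈ blockEdges m,
      forcesEdge (additiveMatrix x₀ x₁ x₂ x₃ x₄) (place t c s c' s' x.1)
        (place t c s c' s' x.2) = true := by
  decide +kernel

/-! ### Skewness of rectangles -/

open Classical in
/-- The difference of the numbers of edges on the two diagonals of the rectangle with rows `i`, `k`
and columns `j`, `l`. -/
noncomputable def skew (A : SimpleGraph (Fin 3 × Fin 3)) (i k j l : Fin 3) : ℤ :=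
  (if A.Adj (i, j) (k, l) then 1 else 0) - (if A.Adj (k, j) (i, l) then 1 else 0)

theorem skew_swap_rows (A : SimpleGraph (Fin 3 × Fin 3)) (i k j l : Fin 3) :
    skew A i k j l = -skew A k i j l := by
  simp [skew]

theorem skew_swap_columns (A : SimpleGraph (Fin 3 × Fin 3)) (i k j l : Fin 3) :
    skew A i k j l = -skew A i k l j := by
  unfold skew
  rw [neg_sub, propext (A.adj_comm (i, l) (k, j)), propext (A.adj_comm (k, l) (i, j))]

theorem skew_self_row (A : SimpleGraph (Fin 3 × Fin 3)) (i j l : Fin 3) :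
    skew A i i j l = 0 := by
  simp [skew]

theorem skew_self_column (A : SimpleGraph (Fin 3 × Fin 3)) (i k j : Fin 3) :
    skew A i k j j = 0 := by
  have := skew_swap_columns A i k j j
  omega

theorem adj_of_skew_eq_one {A : SimpleGraph (Fin 3 × Fin 3)} {i k j l : Fin 3}
    (h : skew A i k j l = 1) : A.Adj (i, j) (k, l) := by
  unfold skew at h
  by_contra hA
  rw [if_neg hA] at h
  split_ifs at h <;> omega

theorem skew_mem (A : SimpleGraph (Fin 3 × Fin 3)) (i k j l : Fin 3) :
    skew A i k j l ∈ [(-1 : ℤ), 0, 1] := by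
  unfold skew
  split_ifs <;> simp

/-- Terms in the row or column of the point cancel, since partial transposition fixes horizontal and
vertical edges. -/
theorem excess_eq_skew (A : SimpleGraph (Fin 3 × Fin 3)) (i j : Fin 3) :
    excess A (i, j) = skew A i (i + 1) j (j + 1) + skew A i (i + 1) j (j + 2)
      + skew A i (i + 2) j (j + 1) + skew A i (i + 2) j (j + 2) := by
  have hsum : ∀ (i : Fin 3) (f : Fin 3 → ℤ), ∑ k, f k = f i + f (i + 1) + f (i + 2) := by
    intro i f
    rw [← Equiv.sum_comp (Equiv.addLeft i), Fin.sum_univ_three]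
    simp
  have h : excess A (i, j) = ∑ k, ∑ l, skew A i k j l := rfl
  rw [h, hsum i, hsum j, hsum j, hsum j]
  simp only [skew_self_row, skew_self_column]
  ring

/-- The skewness of the rectangle avoiding row `a` and column `b`, with cyclic orientation. -/
noncomputable def skewMatrix (A : SimpleGraph (Fin 3 × Fin 3)) (a b : Fin 3) : ℤ :=
  skew A (a + 1) (a + 2) (b + 1) (b + 2)

theorem fin_three_cases : ∀ i k : Fin 3, i ≠ k → k = i + 1 ∨ k = i + 2 := by decide

/-- Here and in the next three lemmas, a step by 1 agrees with the cyclic orientation and a step by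
2 reverses it; each reversal contributes a sign. -/
theorem skew_succ_succ (A : SimpleGraph (Fin 3 × Fin 3)) (i j : Fin 3) :
    skew A i (i + 1) j (j + 1) = skewMatrix A (i + 2) (j + 2) := by
  have h1 : ∀ i : Fin 3, i + 2 + 1 = i := by decide
  have h2 : ∀ i : Fin 3, i + 2 + 2 = i + 1 := by decide
  rw [skewMatrix, h1, h1, h2, h2]

theorem skew_succ_pred (A : SimpleGraph (Fin 3 × Fin 3)) (i j : Fin 3) :
    skew A i (i + 1) j (j + 2) = -skewMatrix A (i + 2) (j + 1) := by
  have h1 : ∀ i : Fin 3, i + 2 + 1 = i := by decide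
  have h2 : ∀ i : Fin 3, i + 2 + 2 = i + 1 := by decide
  have h3 : ∀ i : Fin 3, i + 1 + 1 = i + 2 := by decide
  have h4 : ∀ i : Fin 3, i + 1 + 2 = i := by decide
  rw [skewMatrix, h1, h2, h3, h4, skew_swap_columns]

theorem skew_pred_succ (A : SimpleGraph (Fin 3 × Fin 3)) (i j : Fin 3) :
    skew A i (i + 2) j (j + 1) = -skewMatrix A (i + 1) (j + 2) := by
  have h1 : ∀ i : Fin 3, i + 2 + 1 = i := by decide
  have h2 : ∀ i : Fin 3, i + 2 + 2 = i + 1 := by decide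
  have h3 : ∀ i : Fin 3, i + 1 + 1 = i + 2 := by decide
  have h4 : ∀ i : Fin 3, i + 1 + 2 = i := by decide
  rw [skewMatrix, h1, h2, h3, h4, skew_swap_rows]

theorem skew_pred_pred (A : SimpleGraph (Fin 3 × Fin 3)) (i j : Fin 3) :
    skew A i (i + 2) j (j + 2) = skewMatrix A (i + 1) (j + 1) := by
  have h3 : ∀ i : Fin 3, i + 1 + 1 = i + 2 := by decide
  have h4 : ∀ i : Fin 3, i + 1 + 2 = i := by decide
  rw [skewMatrix, h3, h4, h3, h4, skew_swap_rows, skew_swap_columns, neg_neg]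

theorem adj_of_forcesEdge {A : SimpleGraph (Fin 3 × Fin 3)} {p q : Fin 3 × Fin 3}
    (h : forcesEdge (skewMatrix A) p q = true) : A.Adj p q := by
  obtain ⟨i, j⟩ := p
  obtain ⟨k, l⟩ := q
  apply adj_of_skew_eq_one
  simp only [forcesEdge, Bool.cond_eq_ite, beq_iff_eq] at h
  split_ifs at h with h1 h2 h2 h1 h2 h2 <;> first | exact absurd h (by decide) | subst h1 h2
  · rw [skew_succ_succ]; simpa using h
  · rw [skew_succ_pred, beq_iff_eq.1 h]; rfl
  · rw [skew_pred_pred]; simpa using h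
  · rw [skew_pred_succ, beq_iff_eq.1 h]; rfl

/-- All edges of a graph on the grid are diagonal. -/
def AllDiagonal (A : SimpleGraph (Fin 3 × Fin 3)) : Prop :=
  ∀ i k j l, A.Adj (i, j) (k, l) → i ≠ k ∧ j ≠ l

/-- With no rectangle having both diagonals, any edge would give its rectangle skewness 1, visible
up to sign in the matrix. -/
theorem eq_bot_of_skewMatrix_eq_zero {A : SimpleGraph (Fin 3 × Fin 3)} (hA : AllDiagonal A)
    (hd : ∀ i k j l, A.Adj (i, j) (k, l) → ¬A.Adj (k, j) (i, l))
    (h0 : ∀ a b, skewMatrix A a b = 0) : A = ⊥ := by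
  rw [← SimpleGraph.edgeSet_eq_empty, Set.eq_empty_iff_forall_notMem]
  rintro ⟨⟨i, j⟩, ⟨k, l⟩⟩ h
  replace h : A.Adj (i, j) (k, l) := h
  have h1 : skew A i k j l = 1 := by simp [skew, h, hd i k j l h]
  obtain ⟨hik, hjl⟩ := hA _ _ _ _ h
  rcases fin_three_cases i k hik with rfl | rfl <;>
    rcases fin_three_cases j l hjl with rfl | rfl <;>
    simp [skew_succ_succ, skew_succ_pred, skew_pred_succ, skew_pred_pred, h0] at h1

theorem skewMatrix_eq_additiveMatrix {A : SimpleGraph (Fin 3 × Fin 3)}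
    (hA : ∀ p, excess A p = 0) :
    skewMatrix A = additiveMatrix (skewMatrix A 0 0) (skewMatrix A 0 1) (skewMatrix A 0 2)
      (skewMatrix A 1 0) (skewMatrix A 2 0) := by
  have h : ∀ i j, skewMatrix A (i + 2) (j + 2) - skewMatrix A (i + 2) (j + 1)
      - skewMatrix A (i + 1) (j + 2) + skewMatrix A (i + 1) (j + 1) = 0 := by
    intro i j
    rw [← hA (i, j), excess_eq_skew, skew_succ_succ, skew_succ_pred, skew_pred_succ,
      skew_pred_pred]
    ring
  -- These four points give the 2 × 2 minors through the corner `(0, 0)`; each determines one entry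
  -- outside the first row and column.
  have h11 := h 2 2
  have h12 := h 2 1
  have h21 := h 1 2
  have h22 := h 1 1
  simp only [Fin.isValue, show (2 : Fin 3) + 2 = 1 from rfl, show (2 : Fin 3) + 1 = 0 from rfl,
    show (1 : Fin 3) + 2 = 0 from rfl, show (1 : Fin 3) + 1 = 2 from rfl] at h11 h12 h21 h22
  funext a b
  fin_cases a <;> fin_cases b <;> simp [additiveMatrix] <;> omega

/-! ### Splitting off block copies -/

theorem exists_isBlockCopy_le {A : SimpleGraph (Fin 3 × Fin 3)} (hA : AllDiagonal A)
    (hex : ∀ p, excess A p = 0) (hne : A ≠ ⊥) : ∃ H ≤ A, IsBlockCopy H ∧ H ≠ ⊥ := by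
  by_cases hd : ∀ i k j l, A.Adj (i, j) (k, l) → ¬A.Adj (k, j) (i, l)
  · have hmem : ∀ a b, skewMatrix A a b ∈ [(-1 : ℤ), 0, 1] := fun _ _ => skew_mem _ _ _ _ _
    have heq := skewMatrix_eq_additiveMatrix hex
    rcases exists_place_forcesEdge _ (hmem 0 0) _ (hmem 0 1) _ (hmem 0 2) _ (hmem 1 0) _
      (hmem 2 0) (heq ▸ hmem) with h | ⟨m, t, c, s, c', s', h⟩
    · rw [← heq] at h
      exact absurd (eq_bot_of_skewMatrix_eq_zero hA hd h) hne
    · rw [← heq] at h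
      exact exists_isBlockCopy_le_of_place m t c s c' s' fun x hx => adj_of_forcesEdge (h x hx)
  · push Not at hd
    obtain ⟨i, k, j, l, h, h'⟩ := hd
    obtain ⟨hik, hjl⟩ := hA _ _ _ _ h
    have haff : ∀ i k : Fin 3, i ≠ k → ∃ c s, affinePerm c s 0 = i ∧ affinePerm c s 1 = k := by
      decide
    obtain ⟨c, s, rfl, rfl⟩ := haff i k hik
    obtain ⟨c', s', rfl, rfl⟩ := haff j l hjl
    -- Both diagonals are present: an unrotated criss-cross, moved onto this rectangle.
    refine exists_isBlockCopy_le_of_place 0 false c s c' s' ?_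
    simpa [blockEdges, place] using ⟨h, h'.symm⟩

theorem excess_eq_add_of_disjoint {A B C : SimpleGraph (Fin 3 × Fin 3)}
    (h : ∀ p q, C.Adj p q ↔ A.Adj p q ∨ B.Adj p q) (hAB : ∀ p q, A.Adj p q → ¬B.Adj p q)
    (p : Fin 3 × Fin 3) : excess C p = excess A p + excess B p := by
  classical
  have key : ∀ p q, (if C.Adj p q then (1 : ℤ) else 0)
      = (if A.Adj p q then 1 else 0) + (if B.Adj p q then 1 else 0) := by
    intro p q
    by_cases h1 : A.Adj p q
    · simp [h, h1, hAB p q h1]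
    · simp [h, h1]
  simp only [excess, key, ← Finset.sum_add_distrib]
  refine Finset.sum_congr rfl fun k _ => Finset.sum_congr rfl fun l _ => ?_
  ring

theorem exists_decomposition (A : SimpleGraph (Fin 3 × Fin 3)) (hA : AllDiagonal A)
    (hex : ∀ p, excess A p = 0) :
    ∃ (n : ℕ) (X : Fin n → SimpleGraph (Fin 3 × Fin 3)), (∀ i, IsBlockCopy (X i)) ∧
      (∀ i j, i ≠ j → ∀ p q, (X i).Adj p q → ¬(X j).Adj p q) ∧
      ∀ p q, A.Adj p q ↔ ∃ i, (X i).Adj p q := by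
  induction hN : A.edgeSet.ncard using Nat.strong_induction_on generalizing A with
  | _ N ih =>
  subst hN
  by_cases hne : A = ⊥
  · exact ⟨0, Fin.elim0, fun i => i.elim0, fun i => i.elim0, by simp [hne]⟩
  obtain ⟨H, hHA, hH, hH0⟩ := exists_isBlockCopy_le hA hex hne
  have hadj : ∀ p q, A.Adj p q ↔ H.Adj p q ∨ (A \ H).Adj p q := by
    intro p q
    rw [SimpleGraph.sdiff_adj]
    have := @hHA p q
    tauto
  have hdisj : ∀ p q, H.Adj p q → ¬(A \ H).Adj p q := fun p q h h' => h'.2 h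
  have hlt : (A \ H).edgeSet.ncard < A.edgeSet.ncard := by
    apply Set.ncard_lt_ncard _ (Set.toFinite _)
    rw [SimpleGraph.edgeSet_ssubset_edgeSet]
    -- If nothing were removed, `H` would be disjoint from `A` while contained in it, hence empty.
    refine lt_of_le_of_ne sdiff_le fun h => hH0 ?_
    rw [sdiff_eq_left] at h
    exact le_bot_iff.1 (h hHA le_rfl)
  obtain ⟨n, X, hX, hXd, hXu⟩ := ih _ hlt (A \ H) (fun i k j l h => hA i k j l h.1) (fun p => by
    have := excess_eq_add_of_disjoint hadj hdisj p
    rw [hex, hH.excess_eq_zero, zero_add] at this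
    exact this.symm) rfl
  refine ⟨n + 1, Fin.cons H X, ?_, ?_, ?_⟩
  · exact Fin.cases hH hX
  · intro i j
    refine Fin.cases ?_ (fun i => ?_) i <;> refine Fin.cases ?_ (fun j => ?_) j
    · exact fun h => absurd rfl h
    · exact fun _ p q h h' => hdisj p q h ((hXu p q).2 ⟨j, h'⟩)
    · exact fun _ p q h h' => hdisj p q h' ((hXu p q).2 ⟨i, h⟩)
    · exact fun h => hXd i j fun e => h (e ▸ rfl)
  · intro p q
    rw [hadj, hXu, Fin.exists_fin_succ]
    rfl

theorem excess_eq_zero_of_decomposition (n : ℕ) : ∀ (A : SimpleGraph (Fin 3 × Fin 3))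
    (X : Fin n → SimpleGraph (Fin 3 × Fin 3)), (∀ i, IsBlockCopy (X i)) →
    (∀ i j, i ≠ j → ∀ p q, (X i).Adj p q → ¬(X j).Adj p q) →
    (∀ p q, A.Adj p q ↔ ∃ i, (X i).Adj p q) → ∀ p, excess A p = 0 := by
  induction n with
  | zero =>
    intro A X _ _ h p
    simp [excess, h]
  | succ n ih =>
    intro A X hX hd hu p
    let B : SimpleGraph (Fin 3 × Fin 3) := ⨆ i : Fin n, X i.succ
    have hB : ∀ p q, B.Adj p q ↔ ∃ i : Fin n, (X i.succ).Adj p q := by simp [B]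
    rw [excess_eq_add_of_disjoint (A := X 0) (B := B)
      (fun p q => by rw [hu, hB, Fin.exists_fin_succ]) ?_ p, (hX 0).excess_eq_zero,
      ih B (fun i => X i.succ) (fun i => hX _) (fun i j h => hd _ _ (by simpa using h)) hB, add_zero]
    intro p q h h'
    obtain ⟨i, hi⟩ := (hB p q).1 h'
    exact hd 0 i.succ (Fin.succ_ne_zero i).symm p q h hi

/-! ### Passage between the grid and labelled vertices -/

theorem isBlockCopy_onGrid_iff {V : Type*} (G : GridLabelledGraph V 3 3) :
    IsBlockCopy G.onGrid ↔ ∃ B R : GridLabelledGraph (Fin 3 × Fin 3) 3 3,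
      B.IsBuildingBlock ∧ R.IsRotationOf B ∧ G.LocallyIsomorphic R :=
  Iff.rfl

theorem adj_iff_onGrid_adj {V : Type*} (G : GridLabelledGraph V 3 3) (u v : V) :
    G.graph.Adj u v ↔ G.onGrid.Adj (G.label u) (G.label v) := by
  simp [onGrid]

end GridLabelledGraph

open GridLabelledGraph in
theorem mainTheorem3 {V : Type*} (G : GridLabelledGraph V 3 3) (hG : G.OnlyDiagonalEdges) :
    G.DegreeCriterion ↔
      ∃ (n : ℕ) (X : Fin n → GridLabelledGraph V 3 3), G.IsDecomposition X ∧
        ∀ i, ∃ B R : GridLabelledGraph (Fin 3 × Fin 3) 3 3,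
          B.IsBuildingBlock ∧ R.IsRotationOf B ∧ (X i).LocallyIsomorphic R := by
  rw [degreeCriterion_iff]
  constructor
  · intro h
    obtain ⟨n, X, hX, hd, hu⟩ :=
      exists_decomposition G.onGrid (fun i k j l h => hG i k j l h) h
    let Y : Fin n → GridLabelledGraph V 3 3 := fun i => ⟨(X i).comap G.label, G.label⟩
    have hY : ∀ i, (Y i).onGrid = X i := fun i => by
      ext p q
      simp [Y, onGrid]
    have huY : ∀ u v, G.graph.Adj u v ↔ ∃ i, (Y i).graph.Adj u v := fun u v => by
      rw [adj_iff_onGrid_adj, hu]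
      rfl
    refine ⟨n, Y, ⟨fun i => ⟨rfl, ?_⟩, fun i j hij => ?_, ?_⟩, fun i => ?_⟩
    · rintro ⟨u, v⟩ he
      exact (huY u v).2 ⟨i, he⟩
    · rw [Set.disjoint_left]
      rintro ⟨u, v⟩ he he'
      exact hd i j hij _ _ he he'
    · ext ⟨u, v⟩
      rw [Set.mem_iUnion]
      exact (huY u v).symm
    · rw [← isBlockCopy_onGrid_iff, hY]
      exact hX i
  · rintro ⟨n, X, ⟨hs, hd, hu⟩, hX⟩
    have hadj : ∀ i p q, (X i).onGrid.Adj p q ↔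
        s(G.label.symm p, G.label.symm q) ∈ (X i).graph.edgeSet := fun i p q => by
      -- All pieces carry the labelling of `G`, so their edges can be compared on the grid.
      rw [← (hs i).1]
      rfl
    refine excess_eq_zero_of_decomposition n _ (fun i => (X i).onGrid) hX ?_ ?_
    · intro i j hij p q h h'
      exact Set.disjoint_left.1 (hd i j hij) ((hadj i p q).1 h) ((hadj j p q).1 h')
    · intro p q
      simp only [hadj]
      rw [← Set.mem_iUnion, hu]
      rfl
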